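/- Let $(G,c)$ be a colored DAG: $G=(V,E)$ is a finite directed acyclic graph and $c\colon V\sqcup E\to C$ is a map to a finite set with $c(V)\cap c(E)=\emptyset$. Write $\mathrm{pa}(j)$ for the set of parents of $j$. Let $\mathbb R[\Sigma]$ be the polynomial ring in the variables $\sigma_{ij}=\sigma_{ji}$ ($i,j\in V$), and $\Sigma=(\sigma_{ij})$ the symmetric matrix of variables. For $A,K\subseteq V$ write $|\Sigma_A|$ for the principal minor with rows and columns $A$ (so $|\Sigma_\emptyset|=1$), and $|\Sigma_{ij|K}|$ for the determinant with rows $\{i\}\cup K$ and columns $\{j\}\cup K$, where row $i$ and column $j$ stand in the same position. The colored Gaussian DAG model $\mathcal M(G,c)$ is the set of all matrices $(\mathbb 1-\Lambda)^{-T}\,\Omega\,(\mathbb 1-\Lambda)^{-1}$, where $\Omega=\mathrm{diag}(\omega_i)_{i\in V}$ has positive diagonal, $\Lambda=(\lambda_{ij})$ is a real $V\times V$ matrix with $\lambda_{ij}=0$ for $ij\notin E$, and $\omega_i=\omega_j$ whenever $c(i)=c(j)$, and $\lambda_{ij}=\lambda_{kl}$ whenever $ij,kl\in E$ and $c(ij)=c(kl)$.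 Its vanishing ideal $P_{G,c}\subseteq\mathbb R[\Sigma]$ is the kernel of the pullback $\phi_{G,c}^*\colon\mathbb R[\Sigma]\to\mathbb R[\Omega,\Lambda]$ of this parametrization, where the target has one variable for each vertex color and one for each edge color that occurs. Fix a topological ordering of $V$, and write $i<j$ if $i$ precedes $j$ (so $i<j$ for every edge $i\to j$). The local colored conditional independence ideal is $I_{G,c}=I_G+I_c$, where $I_G$ is generated by the polynomials $$|\Sigma_{ij|\mathrm{pa}(j)}|\qquad (i<j,\ ij\notin E),$$ and $I_c$ is generated by the polynomials $$|\Sigma_{\mathrm{pa}(j)}|\,|\Sigma_{\mathrm{pa}(i)\cup i}|-|\Sigma_{\mathrm{pa}(i)}|\,|\Sigma_{\mathrm{pa}(j)\cup j}|\qquad (i,j\in V,\ c(i)=c(j)),$$ $$|\Sigma_{\mathrm{pa}(l)}|\,|\Sigma_{ij|\mathrm{pa}(j)\setminus i}|-|\Sigma_{\mathrm{pa}(j)}|\,|\Sigma_{kl|\mathrm{pa}(l)\setminus k}|\qquad (ij,kl\in E,\ c(ij)=c(kl)).$$ Let $S_G=\{\prod_{i\in V}|\Sigma_{\mathrm{pa}(i)}|^{k_i}: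 k_i\in\mathbb N\}$ be the multiplicatively closed set generated by the parental principal minors. Theorem. For every colored DAG $(G,c)$ and every topological ordering of $G$, $$P_{G,c}=I_{G,c}:S_G=\{f\in\mathbb R[\Sigma] : fg\in I_{G,c}\text{ for some } g\in S_G\},$$ and this ideal is also the set of all $f\in\mathbb R[\Sigma]$ that vanish at every $\Sigma\in\mathcal M(G,c)$. -/

import Mathlib

/-- A colored directed acyclic graph: a digraph on `V` without directed cycles (in particular
without loops), together with a map coloring its vertices and its edges by elements of `C`, such
that no vertex has the color of an edge. -/
structure ColoredDAG (V C : Type*) where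
  /-- The underlying directed graph; `graph.Adj i j` means `i → j`. -/
  graph : Digraph V
  /-- There is no directed cycle. -/
  acyclic : ∀ v, ¬ Relation.TransGen graph.Adj v v
  /-- The coloring of the disjoint union of the vertex set and the edge set. -/
  color : V ⊕ {e : V × V // graph.Adj e.1 e.2} → C
  /-- Vertex colors and edge colors are disjoint. -/
  color_disjoint : ∀ i e, color (Sum.inl i) ≠ color (Sum.inr e)

namespace ColoredDAG

noncomputable section

variable {V C : Type*}

/-- The color `c(i)` of a vertex. -/
def vertexColor (G : ColoredDAG V C) (i : V) : C :=
  G.color (Sum.inl i)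

/-- The color `c(ij)` of an edge `i → j`. -/
def edgeColor (G : ColoredDAG V C) {i j : V} (h : G.graph.Adj i j) : C :=
  G.color (Sum.inr ⟨(i, j), h⟩)

open Classical in
/-- The parents of a vertex. -/
def parents [Fintype V] (G : ColoredDAG V C) (j : V) : Finset V :=
  Finset.univ.filter fun i => G.graph.Adj i j

/-- `π` lists the vertices in a topological ordering: `i` precedes `j` for every edge `i → j`. -/
def IsTopologicalOrdering [Fintype V] (G : ColoredDAG V C)
    (π : V ≃ Fin (Fintype.card V)) : Prop :=
  ∀ i j, G.graph.Adj i j → π i < π j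

/-- Every DAG has a topological ordering. -/
theorem exists_isTopologicalOrdering [Fintype V] (G : ColoredDAG V C) :
    ∃ π : V ≃ Fin (Fintype.card V), G.IsTopologicalOrdering π := by
  classical
  have hpo : IsPartialOrder V (Relation.ReflTransGen G.graph.Adj) :=
    { refl := fun _ => Relation.ReflTransGen.refl
      trans := fun _ _ _ h₁ h₂ => h₁.trans h₂
      antisymm := by
        intro a b hab hba
        rcases Relation.reflTransGen_iff_eq_or_transGen.1 hab with h | h
        · exact h.symm
        · exact absurd (h.trans_left hba) (G.acyclic a) }
  obtain ⟨s, hs, hle⟩ := extend_partialOrder (Relation.ReflTransGen G.graph.Adj)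
  let L : LinearOrder V :=
    { le := s
      le_refl := fun a => hs.toIsPartialOrder.toIsPreorder.toRefl.refl a
      le_trans := fun _ _ _ h₁ h₂ => hs.toIsPartialOrder.toIsPreorder.toIsTrans.trans _ _ _ h₁ h₂
      le_antisymm := fun _ _ h₁ h₂ => hs.toIsPartialOrder.toAntisymm.antisymm _ _ h₁ h₂
      le_total := fun a b => hs.toTotal.total a b
      toDecidableLE := Classical.decRel _ }
  let e := Fintype.orderIsoFinOfCardEq V rfl
  refine ⟨e.symm.toEquiv, fun i j hij => ?_⟩
  have h₁ : i ≤ j := hle _ _ (Relation.ReflTransGen.single hij)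
  have h₂ : i ≠ j := by
    rintro rfl
    exact G.acyclic i (Relation.TransGen.single hij)
  exact e.symm.strictMono (lt_of_le_of_ne h₁ h₂)

/-! ### The covariance parametrization and the colored Gaussian DAG model -/

/-- The covariance matrix `(1 - Λ)⁻ᵀ Ω (1 - Λ)⁻¹`, with `Ω` the diagonal matrix of `ω`. -/
def covariance {R : Type*} [CommRing R] [Fintype V] [DecidableEq V]
    (ω : V → R) (Λ : Matrix V V R) : Matrix V V R :=
  ((1 - Λ)⁻¹).transpose * Matrix.diagonal ω * (1 - Λ)⁻¹

theorem covariance_symm {R : Type*} [CommRing R] [Fintype V] [DecidableEq V]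
    (ω : V → R) (Λ : Matrix V V R) (i j : V) : covariance ω Λ i j = covariance ω Λ j i := by
  have h : (covariance ω Λ).transpose = covariance ω Λ := by
    simp [covariance, Matrix.transpose_mul, Matrix.mul_assoc]
  exact congrFun (congrFun h j) i

/-- The colored parameter space: positive error variances and real structural coefficients
supported on the edges, where vertices (edges) of the same color have the same parameter. -/
def parameterSpace (G : ColoredDAG V C) : Set ((V → ℝ) × Matrix V V ℝ) :=
  {p | (∀ i, 0 < p.1 i) ∧
    (∀ i j, G.vertexColor i = G.vertexColor j → p.1 i = p.1 j) ∧
    (∀ i j, ¬ G.graph.Adj i j → p.2 i j = 0) ∧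
    ∀ i j k l (h : G.graph.Adj i j) (h' : G.graph.Adj k l),
      G.edgeColor h = G.edgeColor h' → p.2 i j = p.2 k l}

/-- The colored Gaussian DAG model, as a set of covariance matrices. -/
def model [Fintype V] [DecidableEq V] (G : ColoredDAG V C) : Set (Matrix V V ℝ) :=
  (fun p => covariance p.1 p.2) '' G.parameterSpace

/-- The symmetric matrix whose entry at `(i, j)` is the coordinate `x s(i, j)`. -/
def symmMatrix {R : Type*} (x : Sym2 V → R) : Matrix V V R :=
  Matrix.of fun i j => x s(i, j)

/-- The covariance matrices of the model (all of which are symmetric) in the coordinates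
`σ_{ij} = σ_{ji}`. -/
def modelPoints [Fintype V] [DecidableEq V] (G : ColoredDAG V C) : Set (Sym2 V → ℝ) :=
  {x | symmMatrix x ∈ G.model}

/-! ### The vanishing ideal

`MvPolynomial (Sym2 V) ℝ` is the ring `ℝ[Σ]` in the variables `σ_{ij} = σ_{ji}`, and
`MvPolynomial (Set.range G.color) ℝ` is the parameter ring, with one variable for each vertex
color (an `ω`) and one for each edge color (a `λ`). -/

/-- The variable `ω_{c(i)}`. -/
def omegaVar (G : ColoredDAG V C) (i : V) : MvPolynomial (Set.range G.color) ℝ :=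
  MvPolynomial.X ⟨G.color (Sum.inl i), Set.mem_range_self _⟩

open Classical in
/-- The matrix with entry `λ_{c(ij)}` at every edge `i → j` and zeros elsewhere. -/
def lambdaVar (G : ColoredDAG V C) : Matrix V V (MvPolynomial (Set.range G.color) ℝ) :=
  Matrix.of fun i j =>
    if h : G.graph.Adj i j then
      MvPolynomial.X ⟨G.color (Sum.inr ⟨(i, j), h⟩), Set.mem_range_self _⟩
    else 0

/-- The pullback `ℝ[Σ] → ℝ[Ω, Λ]` of the parametrization of the model. -/
def pullback [Fintype V] [DecidableEq V] (G : ColoredDAG V C) :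
    MvPolynomial (Sym2 V) ℝ →ₐ[ℝ] MvPolynomial (Set.range G.color) ℝ :=
  MvPolynomial.aeval
    (Sym2.lift ⟨fun i j => covariance G.omegaVar G.lambdaVar i j, covariance_symm _ _⟩)

/-- The vanishing ideal `P_{G,c}`: the kernel of the pullback. -/
def vanishingIdeal [Fintype V] [DecidableEq V] (G : ColoredDAG V C) :
    Ideal (MvPolynomial (Sym2 V) ℝ) :=
  RingHom.ker G.pullback

/-! ### Minors and the local colored conditional independence ideal -/

/-- The symmetric matrix `Σ` of variables. -/
def sigmaVar (V : Type*) : Matrix V V (MvPolynomial (Sym2 V) ℝ) :=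
  symmMatrix MvPolynomial.X

/-- The principal minor `|Σ_A|`. -/
def principalMinor [DecidableEq V] (A : Finset V) : MvPolynomial (Sym2 V) ℝ :=
  ((sigmaVar V).submatrix (fun a : A => (a : V)) (fun a : A => (a : V))).det

/-- The almost-principal minor `|Σ_{ij|K}|`, with rows `i, K` and columns `j, K`, where the row `i`
and the column `j` are in the same position. -/
def almostPrincipalMinor [DecidableEq V] (i j : V) (K : Finset V) : MvPolynomial (Sym2 V) ℝ :=
  ((sigmaVar V).submatrix (fun a : Option K => a.elim i (fun k => (k : V)))
    (fun a : Option K => a.elim j (fun k => (k : V)))).det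

variable [Fintype V] [DecidableEq V]

/-- The vertex coloring relation
`|Σ_{pa(i)}| |Σ_{pa(j)}| (ω_{i|pa(i)} - ω_{j|pa(j)})`, where `ω_{i|A} = |Σ_{i ∪ A}| / |Σ_A|`. -/
def vcr (G : ColoredDAG V C) (i j : V) : MvPolynomial (Sym2 V) ℝ :=
  principalMinor (G.parents j) * principalMinor (insert i (G.parents i)) -
    principalMinor (G.parents i) * principalMinor (insert j (G.parents j))

/-- The edge coloring relation `|Σ_{pa(j)}| |Σ_{pa(l)}| (λ_{ij|pa(j)} - λ_{kl|pa(l)})`,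
where `λ_{ij|A} = |Σ_{ij|A ∖ i}| / |Σ_A|`. -/
def ecr (G : ColoredDAG V C) (i j k l : V) : MvPolynomial (Sym2 V) ℝ :=
  principalMinor (G.parents l) * almostPrincipalMinor i j ((G.parents j).erase i) -
    principalMinor (G.parents j) * almostPrincipalMinor k l ((G.parents l).erase k)

/-- The conditional independence relation `|Σ_{pa(j)}| λ_{ij|pa(j)}`. -/
def cir (G : ColoredDAG V C) (i j : V) : MvPolynomial (Sym2 V) ℝ :=
  almostPrincipalMinor i j ((G.parents j).erase i)

/-- The ideal `I_G` generated by the conditional independence relations of the non-edges `ij`,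
where `i` precedes `j` in the given topological ordering. -/
def ciIdeal (G : ColoredDAG V C) (π : V ≃ Fin (Fintype.card V)) :
    Ideal (MvPolynomial (Sym2 V) ℝ) :=
  Ideal.span {f | ∃ i j, π i < π j ∧ ¬ G.graph.Adj i j ∧ f = G.cir i j}

/-- The ideal `I_c` generated by the vertex and edge coloring relations. -/
def coloringIdeal (G : ColoredDAG V C) : Ideal (MvPolynomial (Sym2 V) ℝ) :=
  Ideal.span
    ({f | ∃ i j, G.vertexColor i = G.vertexColor j ∧ f = G.vcr i j} ∪
     {f | ∃ i j k l, ∃ (h : G.graph.Adj i j) (h' : G.graph.Adj k l),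
        G.edgeColor h = G.edgeColor h' ∧ f = G.ecr i j k l})

/-- The local colored conditional independence ideal `I_{G,c} = I_G + I_c`. -/
def localCIIdeal (G : ColoredDAG V C) (π : V ≃ Fin (Fintype.card V)) :
    Ideal (MvPolynomial (Sym2 V) ℝ) :=
  G.ciIdeal π + G.coloringIdeal

/-- The multiplicatively closed set `S_G` of all products of parental principal minors. -/
def parentalMinors (G : ColoredDAG V C) : Submonoid (MvPolynomial (Sym2 V) ℝ) where
  carrier := {s | ∃ k : V → ℕ, s = ∏ i, principalMinor (G.parents i) ^ k i}
  one_mem' := ⟨0, by simp⟩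
  mul_mem' := by
    rintro _ _ ⟨k, rfl⟩ ⟨l, rfl⟩
    exact ⟨k + l, by simp [pow_add, Finset.prod_mul_distrib]⟩

end

end ColoredDAG

/-- The saturation `I : S` of an ideal by a multiplicatively closed set. -/
def Ideal.saturationBy {R : Type*} [CommRing R] (I : Ideal R) (S : Submonoid R) : Ideal R where
  carrier := {f | ∃ g ∈ S, f * g ∈ I}
  zero_mem' := ⟨1, S.one_mem, by simp⟩
  add_mem' := by
    rintro a b ⟨g, hg, hag⟩ ⟨h, hh, hbh⟩
    refine ⟨g * h, S.mul_mem hg hh, ?_⟩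
    have : (a + b) * (g * h) = h * (a * g) + g * (b * h) := by ring
    rw [this]
    exact I.add_mem (I.mul_mem_left _ hag) (I.mul_mem_left _ hbh)
  smul_mem' := by
    rintro c a ⟨g, hg, hag⟩
    refine ⟨g, hg, ?_⟩
    rw [smul_eq_mul, mul_assoc]
    exact I.mul_mem_left _ hag

/-!
Write `Λ` for a strictly upper triangular matrix (with respect to the topological ordering). A
symmetric matrix `M` over any commutative ring is the covariance matrix `(1 - Λ)⁻ᵀ Ω (1 - Λ)⁻¹` if
and only if it satisfies the structural equations
`M_{ij} = ∑_k M_{ik} λ_{kj} + δ_{ij} ω_j` for all `i` not after `j`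
(`covariance_apply_of_le`, `eq_covariance_of_structural_equations`). Where the parental principal
minors are invertible, these equations can be expressed by minors: by Cramer's rule and a Schur
complement computation, they force `λ_{ij} |M_{pa(j)}| = |M_{ij|pa(j) ∖ i}|` and
`ω_j |M_{pa(j)}| = |M_{pa(j) ∪ j}|`, and the equations at non-edges become the vanishing of the
conditional independence relations (`Matrix.almostPrincipalDet_erase_of_regression`,
`Matrix.almostPrincipalDet_of_regression`).

* Hence the local relations vanish on every covariance matrix with colored parameters, in
  particular on the generic one (`localCIIdeal_le_ker`). The parental minors do not vanish on the
  generic covariance matrix, as they are `1` at the identity matrix, and the parameter ring is a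
  domain. So the saturation is contained in the kernel of the pullback.
* Conversely, let `L` be the localization of `ℝ[Σ] / I_{G,c}` at the parental minors. Over `L` the
  formulas above define `ω` and `Λ`, which respect the coloring because of the coloring relations,
  and the image of `Σ` in `L` is their covariance matrix
  (`exists_isColoredParameter_of_localCIIdeal_le_ker`). So `ℝ[Σ] → L` factors through the pullback
  (`exists_eq_comp_pullback`), and the kernel of the pullback is contained in the kernel of
  `ℝ[Σ] → L`, which is the saturation.
* A polynomial vanishes on the model if and only if its pullback vanishes for all positive `ω` and
  all real `λ`. Vertex and edge colors are disjoint, so these parameters include a product of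
  infinite sets of reals, on which only the zero polynomial vanishes (`vanishingIdeal_modelPoints`).
-/

/-! ### Principal and almost-principal minors of a matrix -/

namespace Matrix

variable {V A : Type*} [DecidableEq V] [CommRing A]

/-- The principal minor of `M` with rows and columns `K`. -/
def principalDet (M : Matrix V V A) (K : Finset V) : A :=
  (M.submatrix (fun a : K => (a : V)) (fun a : K => (a : V))).det

/-- The minor of `M` with rows `i, K` and columns `j, K`, where row `i` and column `j` are in the
same position. -/
def almostPrincipalDet (M : Matrix V V A) (i j : V) (K : Finset V) : A :=
  (M.submatrix (fun a : Option K => a.elim i (fun k => (k : V)))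
    (fun a : Option K => a.elim j (fun k => (k : V)))).det

theorem principalDet_insert (M : Matrix V V A) {j : V} {K : Finset V} (hj : j ∉ K) :
    M.principalDet (insert j K) = M.almostPrincipalDet j j K := by
  unfold principalDet almostPrincipalDet
  rw [← det_submatrix_equiv_self (Finset.subtypeInsertEquivOption hj).symm]
  congr 1
  ext a b
  cases a <;> cases b <;> rfl

/-- Minors of the form `|M_{ij|K ∖ i}|` with `i ∈ K` are the numerators in Cramer's rule for the
linear system whose matrix is the block `M_K` and whose right-hand side is column `j`. -/
theorem almostPrincipalDet_erase (M : Matrix V V A) {i j : V} {K : Finset V} (hi : i ∈ K) :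
    M.almostPrincipalDet i j (K.erase i) =
      cramer (M.submatrix (fun a : K => (a : V)) (fun a : K => (a : V))) (fun k => M k j)
        ⟨i, hi⟩ := by
  let f : Option (K.erase i) → K :=
    fun a => a.elim ⟨i, hi⟩ (fun k => ⟨k, Finset.mem_of_mem_erase k.2⟩)
  have hne (k : K.erase i) : (k : V) ≠ i := Finset.ne_of_mem_erase k.2
  have hf : Function.Bijective f := by
    constructor
    · rintro (_ | a) (_ | b) h
      · rfl
      · exact absurd (congrArg Subtype.val h).symm (hne b)
      · exact absurd (congrArg Subtype.val h) (hne a)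
      · exact congrArg some (Subtype.ext (congrArg (fun x : K => (x : V)) h))
    · intro k
      by_cases hk : (k : V) = i
      · exact ⟨none, Subtype.ext hk.symm⟩
      · exact ⟨some ⟨k, Finset.mem_erase.2 ⟨hk, k.2⟩⟩, rfl⟩
  rw [cramer_apply, almostPrincipalDet, ← det_submatrix_equiv_self (Equiv.ofBijective f hf)]
  congr 1
  ext a b
  rcases b with _ | b
  · rcases a with _ | a <;> simp [f]
  · have hb : f (some b) ≠ ⟨i, hi⟩ := fun h => hne b (congrArg Subtype.val h)
    rcases a with _ | a <;> simp [updateCol_ne hb] <;> simp [f]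

theorem sum_mul_almostPrincipalDet_erase (M : Matrix V V A) {j k : V} {K : Finset V}
    (hk : k ∈ K) :
    ∑ l ∈ K, M k l * M.almostPrincipalDet l j (K.erase l) = M.principalDet K * M k j := by
  have h := congrFun (mulVec_cramer (M.submatrix (fun a : K => (a : V)) (fun a : K => (a : V)))
    (fun k => M k j)) ⟨k, hk⟩
  simp only [Pi.smul_apply, smul_eq_mul] at h
  rw [principalDet, ← h, ← Finset.sum_coe_sort K]
  simp only [mulVec, dotProduct, submatrix_apply]
  exact Finset.sum_congr rfl fun l _ => by rw [almostPrincipalDet_erase M l.2]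

/-- Cramer's rule: if column `j` is, within the rows `K`, the combination of the columns `K` with
coefficients `β`, then `|M_{ij|K ∖ i}| = β i |M_K|`. -/
theorem almostPrincipalDet_erase_of_regression (M : Matrix V V A) {i j : V} {K : Finset V}
    {β : V → A} (hβ : ∀ k ∈ K, M k j = ∑ l ∈ K, M k l * β l) (hi : i ∈ K) :
    M.almostPrincipalDet i j (K.erase i) = β i * M.principalDet K := by
  have hcol : (fun k : K => M k j) =
      M.submatrix (fun a : K => (a : V)) (fun a : K => (a : V)) *ᵥ fun l : K => β l := by
    ext k
    rw [hβ k k.2, ← Finset.sum_coe_sort K]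
    rfl
  rw [almostPrincipalDet_erase M hi, hcol, cramer_eq_adjugate_mulVec, mulVec_mulVec, adjugate_mul,
    smul_mulVec, one_mulVec]
  simp [principalDet, mul_comm]

/-- The Schur complement of `M_K` in an almost-principal minor: if column `j` is, within the rows
`K`, the combination of the columns `K` with coefficients `β`, then `|M_{ij|K}|` is `|M_K|` times
the residual of that combination in row `i`. -/
theorem almostPrincipalDet_of_regression (M : Matrix V V A) (i : V) {j : V} {K : Finset V}
    {β : V → A} (hβ : ∀ k ∈ K, M k j = ∑ l ∈ K, M k l * β l) :
    M.almostPrincipalDet i j K = (M i j - ∑ l ∈ K, M i l * β l) * M.principalDet K := by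
  let B : Matrix K K A := M.submatrix (fun a => (a : V)) (fun a => (a : V))
  let R : Matrix Unit K A := of fun _ l => M i l
  let b : Matrix K Unit A := of fun l _ => β l
  let d : Matrix Unit Unit A := of fun _ _ => M i j - ∑ l ∈ K, M i l * β l
  -- The right factor encodes adding multiples of the columns `K` to column `j`.
  have hfac : (M.submatrix (fun a : Option K => a.elim i (fun k => (k : V)))
      (fun a : Option K => a.elim j (fun k => (k : V)))).submatrix
        (Equiv.optionEquivSumPUnit K).symm (Equiv.optionEquivSumPUnit K).symm =
      fromBlocks B 0 R d * fromBlocks 1 b 0 1 := by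
    rw [fromBlocks_multiply]
    ext x y
    rcases x with x | x <;> rcases y with y | y
    · simp [B]
    · simp only [Matrix.mul_apply, fromBlocks_apply₁₂, Matrix.add_apply, submatrix_apply]
      simpa [B, b] using (hβ x x.2).trans (Finset.sum_coe_sort K (fun l => M x l * β l)).symm
    · simp [R]
    · have := Finset.sum_coe_sort K (fun l => M i l * β l)
      simp [Matrix.mul_apply, R, b, d, ← this]
  rw [almostPrincipalDet, ← det_submatrix_equiv_self (Equiv.optionEquivSumPUnit K).symm, hfac,
    det_mul, det_fromBlocks_zero₁₂, det_fromBlocks_zero₂₁]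
  simp [d, B, principalDet, mul_comm]

end Matrix

/-! ### Covariance matrices and their structural equations -/

namespace ColoredDAG

noncomputable section

section Covariance

variable {V A : Type*} [CommRing A]

/-- `Λ` is strictly upper triangular with respect to the ordering `π`. -/
def IsStrictlyUpper {n : ℕ} (π : V ≃ Fin n) (Λ : Matrix V V A) : Prop :=
  ∀ i j, ¬ π i < π j → Λ i j = 0

variable {n : ℕ} {π : V ≃ Fin n} {ω : V → A} {Λ : Matrix V V A}

theorem IsStrictlyUpper.map {B : Type*} [CommRing B] (hΛ : IsStrictlyUpper π Λ) (f : A →+* B) :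
    IsStrictlyUpper π (Λ.map f) := fun i j hij => by simp [hΛ i j hij]

theorem IsStrictlyUpper.blockTriangular [DecidableEq V] (hΛ : IsStrictlyUpper π Λ) :
    (1 - Λ).BlockTriangular π := by
  intro i j hij
  have hne : i ≠ j := by
    rintro rfl
    exact lt_irrefl _ hij
  simp [hne, hΛ i j hij.not_gt]

variable [Fintype V] [DecidableEq V]

theorem IsStrictlyUpper.det_one_sub (hΛ : IsStrictlyUpper π Λ) : (1 - Λ).det = 1 := by
  let : LinearOrder V := LinearOrder.lift' π π.injective
  have h : (1 - Λ).BlockTriangular id := fun i j hij => hΛ.blockTriangular hij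
  rw [Matrix.det_of_isUpperTriangular h]
  exact Finset.prod_eq_one fun i _ => by simp [hΛ i i (lt_irrefl _)]

theorem IsStrictlyUpper.isUnit_det (hΛ : IsStrictlyUpper π Λ) : IsUnit (1 - Λ).det := by
  rw [hΛ.det_one_sub]
  exact isUnit_one

theorem IsStrictlyUpper.inv_apply_of_lt (hΛ : IsStrictlyUpper π Λ) {i j : V} (h : π j < π i) :
    (1 - Λ)⁻¹ i j = 0 := by
  let := Matrix.invertibleOfIsUnitDet _ hΛ.isUnit_det
  exact Matrix.blockTriangular_inv_of_blockTriangular hΛ.blockTriangular h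

theorem IsStrictlyUpper.inv_apply_self (hΛ : IsStrictlyUpper π Λ) (i : V) :
    (1 - Λ)⁻¹ i i = 1 := by
  have h := congrFun (congrFun (Matrix.mul_nonsing_inv _ hΛ.isUnit_det) i) i
  rw [Matrix.sub_mul, Matrix.one_mul, Matrix.sub_apply, Matrix.mul_apply, Matrix.one_apply_eq,
    Finset.sum_eq_zero, sub_zero] at h
  · exact h
  · intro k _
    by_cases hk : π i < π k
    · rw [hΛ.inv_apply_of_lt hk, mul_zero]
    · rw [hΛ i k hk, zero_mul]

/-- The structural equations: for `i` not after `j`, the covariance of `i` and `j` is the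
covariance of `i` with the regression `∑ λ_{kj} X_k`, plus the error variance if `i = j`. -/
theorem covariance_apply_of_le (hΛ : IsStrictlyUpper π Λ) {i j : V} (hij : π i ≤ π j) :
    covariance ω Λ i j =
      ∑ k, covariance ω Λ i k * Λ k j + if i = j then ω j else 0 := by
  have h : covariance ω Λ * (1 - Λ) = ((1 - Λ)⁻¹).transpose * Matrix.diagonal ω := by
    rw [covariance, Matrix.mul_assoc, Matrix.nonsing_inv_mul _ hΛ.isUnit_det, Matrix.mul_one]
  have h' := congrFun (congrFun h i) j
  rw [Matrix.mul_sub, Matrix.mul_one, Matrix.sub_apply, Matrix.mul_apply, Matrix.mul_diagonal,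
    Matrix.transpose_apply, sub_eq_iff_eq_add'] at h'
  rw [h']
  congr 1
  split_ifs with e
  · rw [e, hΛ.inv_apply_self, one_mul]
  · rw [hΛ.inv_apply_of_lt (lt_of_le_of_ne hij (π.injective.ne e)), zero_mul]

/-- A symmetric matrix is determined by the structural equations: they say that on and above the
diagonal `(1 - Λ)ᵀ M (1 - Λ)` agrees with `Ω`, and below the diagonal it does so by symmetry. -/
theorem eq_covariance_of_structural_equations (hΛ : IsStrictlyUpper π Λ) {M : Matrix V V A}
    (hM : ∀ i j, M i j = M j i)
    (h : ∀ i j, π i ≤ π j → M i j = ∑ k, M i k * Λ k j + if i = j then ω j else 0) :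
    M = covariance ω Λ := by
  have hMT : M.transpose = M := by
    ext i j
    exact hM j i
  have hL (i j) (hij : π i ≤ π j) : (M * (1 - Λ)) i j = if i = j then ω j else 0 := by
    rw [Matrix.mul_sub, Matrix.mul_one, Matrix.sub_apply, Matrix.mul_apply, h i j hij,
      add_sub_cancel_left]
  set D := (1 - Λ).transpose * (M * (1 - Λ)) with hD
  have hDT : D.transpose = D := by
    simp only [hD, Matrix.transpose_mul, Matrix.transpose_transpose, hMT, Matrix.mul_assoc]
  have hle (i j) (hij : π i ≤ π j) : D i j = Matrix.diagonal ω i j := by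
    rw [hD, Matrix.transpose_sub, Matrix.transpose_one, Matrix.sub_mul, Matrix.one_mul,
      Matrix.sub_apply, hL i j hij, Matrix.mul_apply, Finset.sum_eq_zero, sub_zero,
      Matrix.diagonal_apply]
    · split_ifs with e
      · rw [e]
      · rfl
    · intro k _
      rw [Matrix.transpose_apply]
      by_cases hk : π k < π i
      · have hkj : k ≠ j := by
          rintro rfl
          exact absurd hij hk.not_ge
        rw [hL k j (hk.le.trans hij), if_neg hkj, mul_zero]
      · rw [hΛ k i hk, zero_mul]
  have hdiag : D = Matrix.diagonal ω := by
    ext i j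
    rcases le_total (π i) (π j) with hij | hij
    · exact hle i j hij
    · rw [← hDT, Matrix.transpose_apply, hle j i hij, ← Matrix.transpose_apply (Matrix.diagonal ω),
        Matrix.diagonal_transpose]
  have hu := hΛ.isUnit_det
  have huT : ((1 - Λ)⁻¹).transpose * (1 - Λ).transpose = 1 := by
    rw [← Matrix.transpose_mul, Matrix.mul_nonsing_inv _ hu, Matrix.transpose_one]
  rw [covariance, ← hdiag, hD, ← Matrix.mul_assoc, huT, Matrix.one_mul, Matrix.mul_assoc,
    Matrix.mul_nonsing_inv _ hu, Matrix.mul_one]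

theorem covariance_map {B : Type*} [CommRing B] (hΛ : IsStrictlyUpper π Λ) (f : A →+* B) :
    (covariance ω Λ).map f = covariance (fun i => f (ω i)) (Λ.map f) := by
  refine eq_covariance_of_structural_equations (hΛ.map f) (fun i j => ?_) (fun i j hij => ?_)
  · rw [Matrix.map_apply, Matrix.map_apply, covariance_symm]
  · simpa [apply_ite f] using congrArg f (covariance_apply_of_le (ω := ω) hΛ hij)

end Covariance

end

end ColoredDAG

/-! ### Colored parameters -/

namespace ColoredDAG

noncomputable section

section Parameters

variable {V C A : Type*}

/-- The parameters `ω`, `Λ` over a commutative ring `A` are compatible with the colored graph: `Λ`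
is supported on the edges, and vertices (edges) of the same color have the same parameter. -/
structure IsColoredParameter [Zero A] (G : ColoredDAG V C) (ω : V → A) (Λ : Matrix V V A) :
    Prop where
  omega_eq : ∀ i j, G.vertexColor i = G.vertexColor j → ω i = ω j
  lambda_eq_zero : ∀ i j, ¬ G.graph.Adj i j → Λ i j = 0
  lambda_eq : ∀ i j k l (h : G.graph.Adj i j) (h' : G.graph.Adj k l),
    G.edgeColor h = G.edgeColor h' → Λ i j = Λ k l

theorem IsColoredParameter.isStrictlyUpper [Fintype V] [CommRing A] {G : ColoredDAG V C}
    {π : V ≃ Fin (Fintype.card V)} (hπ : G.IsTopologicalOrdering π) {ω : V → A}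
    {Λ : Matrix V V A} (h : G.IsColoredParameter ω Λ) : IsStrictlyUpper π Λ :=
  fun i j hij => h.lambda_eq_zero i j fun hadj => hij (hπ i j hadj)

theorem IsColoredParameter.sum_mul_eq [Fintype V] [CommRing A] {G : ColoredDAG V C} {ω : V → A}
    {Λ : Matrix V V A} (h : G.IsColoredParameter ω Λ) (x : V → A) (j : V) :
    ∑ k, x k * Λ k j = ∑ k ∈ G.parents j, x k * Λ k j := by
  refine (Finset.sum_subset (Finset.subset_univ _) fun k _ hk => ?_).symm
  rw [h.lambda_eq_zero k j (fun hadj => hk (by simpa [parents] using hadj)), mul_zero]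

theorem mem_parents [Fintype V] {G : ColoredDAG V C} {i j : V} :
    i ∈ G.parents j ↔ G.graph.Adj i j := by
  simp [parents]

theorem notMem_parents_self [Fintype V] (G : ColoredDAG V C) (j : V) : j ∉ G.parents j := fun h =>
  G.acyclic j (Relation.TransGen.single (mem_parents.1 h))

theorem isColoredParameter_vars (G : ColoredDAG V C) :
    G.IsColoredParameter G.omegaVar G.lambdaVar where
  omega_eq i j h := congrArg MvPolynomial.X (Subtype.ext h)
  lambda_eq_zero i j h := by simp [lambdaVar, h]
  lambda_eq i j k l h h' hc := by
    simp only [lambdaVar, Matrix.of_apply, dif_pos h, dif_pos h']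
    exact congrArg MvPolynomial.X (Subtype.ext hc)

/-- Colored parameters over `A` are the same as values for the variables of the parameter ring. -/
theorem IsColoredParameter.exists_eval [CommRing A] [Algebra ℝ A] {G : ColoredDAG V C}
    {ω : V → A} {Λ : Matrix V V A} (h : G.IsColoredParameter ω Λ) :
    ∃ x : Set.range G.color → A, (∀ i, MvPolynomial.aeval x (G.omegaVar i) = ω i) ∧
      ∀ i j, MvPolynomial.aeval x (G.lambdaVar i j) = Λ i j := by
  let val : V ⊕ {e : V × V // G.graph.Adj e.1 e.2} → A :=
    Sum.elim ω fun e => Λ e.1.1 e.1.2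
  -- A vertex and an edge never share a color, so no relation between `ω` and `Λ` is needed.
  have hval (a b) (hab : G.color a = G.color b) : val a = val b := by
    rcases a with i | e <;> rcases b with j | f
    · exact h.omega_eq i j hab
    · exact absurd hab (G.color_disjoint i f)
    · exact absurd hab.symm (G.color_disjoint j e)
    · exact h.lambda_eq _ _ _ _ e.2 f.2 hab
  refine ⟨fun c => val c.2.choose, fun i => ?_, fun i j => ?_⟩
  · rw [omegaVar, MvPolynomial.aeval_X]
    exact hval _ (Sum.inl i) (Exists.choose_spec (Set.mem_range_self (Sum.inl i)))
  · by_cases hadj : G.graph.Adj i j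
    · simp only [lambdaVar, Matrix.of_apply, dif_pos hadj, MvPolynomial.aeval_X]
      exact hval _ (Sum.inr ⟨(i, j), hadj⟩)
        (Exists.choose_spec (Set.mem_range_self (f := G.color) (Sum.inr ⟨(i, j), hadj⟩)))
    · simp [lambdaVar, hadj, h.lambda_eq_zero i j hadj]

theorem IsColoredParameter.map {B : Type*} [CommRing A] [CommRing B] {G : ColoredDAG V C}
    {ω : V → A} {Λ : Matrix V V A} (h : G.IsColoredParameter ω Λ) (f : A →+* B) :
    G.IsColoredParameter (fun i => f (ω i)) (Λ.map f) where
  omega_eq i j hc := congrArg f (h.omega_eq i j hc)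
  lambda_eq_zero i j hadj := by simp [h.lambda_eq_zero i j hadj]
  lambda_eq i j k l hij hkl hc := congrArg f (h.lambda_eq i j k l hij hkl hc)

end Parameters

/-! ### Evaluating the symmetric matrix of variables -/

section Evaluation

variable {V C A : Type*} [CommRing A] [Algebra ℝ A]

/-- The image of the symmetric matrix `Σ` of variables under a homomorphism `ℝ[Σ] → A`. -/
def sigmaImage (q : MvPolynomial (Sym2 V) ℝ →ₐ[ℝ] A) : Matrix V V A :=
  (sigmaVar V).map q

theorem sigmaImage_symm (q : MvPolynomial (Sym2 V) ℝ →ₐ[ℝ] A) (i j : V) :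
    sigmaImage q i j = sigmaImage q j i := by
  simp [sigmaImage, sigmaVar, symmMatrix, Sym2.eq_swap]

theorem apply_principalMinor [DecidableEq V] (q : MvPolynomial (Sym2 V) ℝ →ₐ[ℝ] A)
    (K : Finset V) : q (principalMinor K) = (sigmaImage q).principalDet K := by
  rw [principalMinor, AlgHom.map_det]
  rfl

theorem apply_almostPrincipalMinor [DecidableEq V] (q : MvPolynomial (Sym2 V) ℝ →ₐ[ℝ] A)
    (i j : V) (K : Finset V) :
    q (almostPrincipalMinor i j K) = (sigmaImage q).almostPrincipalDet i j K := by
  rw [almostPrincipalMinor, AlgHom.map_det]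
  rfl

theorem sigmaImage_aeval (x : Sym2 V → A) :
    sigmaImage (MvPolynomial.aeval (R := ℝ) x) = symmMatrix x := by
  ext i j
  simp [sigmaImage, sigmaVar, symmMatrix]

variable [Fintype V] [DecidableEq V]

theorem sigmaImage_pullback (G : ColoredDAG V C) :
    sigmaImage G.pullback = covariance G.omegaVar G.lambdaVar := by
  ext i j
  simp [sigmaImage, sigmaVar, symmMatrix, pullback]

variable {G : ColoredDAG V C} {π : V ≃ Fin (Fintype.card V)} {ω : V → A} {Λ : Matrix V V A}
  {q : MvPolynomial (Sym2 V) ℝ →ₐ[ℝ] A}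

theorem map_covariance_vars (hπ : G.IsTopologicalOrdering π)
    (f : MvPolynomial (Set.range G.color) ℝ →ₐ[ℝ] A) (hω : ∀ i, f (G.omegaVar i) = ω i)
    (hΛ : ∀ i j, f (G.lambdaVar i j) = Λ i j) :
    sigmaImage (f.comp G.pullback) = covariance ω Λ := by
  have h := covariance_map (ω := G.omegaVar)
    (G.isColoredParameter_vars.isStrictlyUpper hπ) f.toRingHom
  have h₁ : sigmaImage (f.comp G.pullback) = (sigmaImage G.pullback).map f.toRingHom := rfl
  rw [h₁, sigmaImage_pullback, h]
  congr 1
  · exact funext hω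
  · ext i j
    exact hΛ i j

/-- A homomorphism that sends `Σ` to the covariance matrix of colored parameters factors through
the parametrization. -/
theorem exists_eq_comp_pullback (hπ : G.IsTopologicalOrdering π) (h : G.IsColoredParameter ω Λ)
    (hq : sigmaImage q = covariance ω Λ) :
    ∃ f : MvPolynomial (Set.range G.color) ℝ →ₐ[ℝ] A, q = f.comp G.pullback := by
  obtain ⟨x, hω, hΛ⟩ := h.exists_eval
  refine ⟨MvPolynomial.aeval x, MvPolynomial.algHom_ext fun s => ?_⟩
  have h₁ := hq.trans (map_covariance_vars hπ (MvPolynomial.aeval x) hω hΛ).symm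
  induction s using Sym2.ind with
  | _ i j => exact congrFun (congrFun h₁ i) j

theorem vanishingIdeal_le_ker (hπ : G.IsTopologicalOrdering π) (h : G.IsColoredParameter ω Λ)
    (hq : sigmaImage q = covariance ω Λ) : G.vanishingIdeal ≤ RingHom.ker q := by
  obtain ⟨f, rfl⟩ := exists_eq_comp_pullback hπ h hq
  intro p hp
  have hp : G.pullback p = 0 := hp
  simp [hp]

end Evaluation

/-! ### The local relations hold on the model -/

section Relations

variable {V C A : Type*} [Fintype V] [DecidableEq V] [CommRing A] [Algebra ℝ A]
  {G : ColoredDAG V C} {π : V ≃ Fin (Fintype.card V)} {ω : V → A} {Λ : Matrix V V A}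
  {q : MvPolynomial (Sym2 V) ℝ →ₐ[ℝ] A}

theorem sigmaImage_apply_of_le (hπ : G.IsTopologicalOrdering π) (h : G.IsColoredParameter ω Λ)
    (hq : sigmaImage q = covariance ω Λ) {i j : V} (hij : π i ≤ π j) : sigmaImage q i j =
      ∑ k ∈ G.parents j, sigmaImage q i k * Λ k j + if i = j then ω j else 0 := by
  rw [hq, covariance_apply_of_le (h.isStrictlyUpper hπ) hij, h.sum_mul_eq]

theorem sigmaImage_apply_of_lt (hπ : G.IsTopologicalOrdering π) (h : G.IsColoredParameter ω Λ)
    (hq : sigmaImage q = covariance ω Λ) {i j : V} (hij : π i < π j) : sigmaImage q i j =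
      ∑ k ∈ G.parents j, sigmaImage q i k * Λ k j := by
  have hne : i ≠ j := by
    rintro rfl
    exact lt_irrefl _ hij
  rw [sigmaImage_apply_of_le hπ h hq hij.le, if_neg hne, add_zero]

theorem apply_principalMinor_insert (hπ : G.IsTopologicalOrdering π)
    (h : G.IsColoredParameter ω Λ) (hq : sigmaImage q = covariance ω Λ) (j : V) :
    q (principalMinor (insert j (G.parents j))) = ω j * q (principalMinor (G.parents j)) := by
  rw [apply_principalMinor, apply_principalMinor,
    Matrix.principalDet_insert _ (G.notMem_parents_self j),
    Matrix.almostPrincipalDet_of_regression _ _ fun k hk =>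
      sigmaImage_apply_of_lt hπ h hq (hπ k j (mem_parents.1 hk)),
    sigmaImage_apply_of_le hπ h hq le_rfl, if_pos rfl, add_sub_cancel_left]

theorem apply_cir_of_adj (hπ : G.IsTopologicalOrdering π) (h : G.IsColoredParameter ω Λ)
    (hq : sigmaImage q = covariance ω Λ) {i j : V} (hij : G.graph.Adj i j) :
    q (G.cir i j) = Λ i j * q (principalMinor (G.parents j)) := by
  rw [cir, apply_almostPrincipalMinor, apply_principalMinor]
  exact Matrix.almostPrincipalDet_erase_of_regression (β := fun l => Λ l j) _ (fun k hk =>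
    sigmaImage_apply_of_lt hπ h hq (hπ k j (mem_parents.1 hk))) (mem_parents.2 hij)

theorem apply_cir_of_not_adj (hπ : G.IsTopologicalOrdering π) (h : G.IsColoredParameter ω Λ)
    (hq : sigmaImage q = covariance ω Λ) {i j : V} (hlt : π i < π j)
    (hij : ¬ G.graph.Adj i j) : q (G.cir i j) = 0 := by
  rw [cir, apply_almostPrincipalMinor, Finset.erase_eq_of_notMem (mt mem_parents.1 hij),
    Matrix.almostPrincipalDet_of_regression _ _ fun k hk =>
      sigmaImage_apply_of_lt hπ h hq (hπ k j (mem_parents.1 hk)),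
    sigmaImage_apply_of_lt hπ h hq hlt, sub_self, zero_mul]

theorem localCIIdeal_le_ker (hπ : G.IsTopologicalOrdering π) (h : G.IsColoredParameter ω Λ)
    (hq : sigmaImage q = covariance ω Λ) : G.localCIIdeal π ≤ RingHom.ker q := by
  refine sup_le (Ideal.span_le.2 ?_) (Ideal.span_le.2 (Set.union_subset ?_ ?_))
  · rintro _ ⟨i, j, hlt, hij, rfl⟩
    exact apply_cir_of_not_adj hπ h hq hlt hij
  · rintro _ ⟨i, j, hc, rfl⟩
    change q (G.vcr i j) = 0
    rw [vcr, map_sub, map_mul, map_mul, apply_principalMinor_insert hπ h hq,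
      apply_principalMinor_insert hπ h hq, h.omega_eq i j hc]
    ring
  · rintro _ ⟨i, j, k, l, hij, hkl, hc, rfl⟩
    have hi := apply_cir_of_adj hπ h hq hij
    have hk := apply_cir_of_adj hπ h hq hkl
    rw [cir] at hi hk
    change q (G.ecr i j k l) = 0
    rw [ecr, map_sub, map_mul, map_mul, hi, hk, h.lambda_eq i j k l hij hkl hc]
    ring

end Relations

section Nonvanishing

variable {V C : Type*} [Fintype V] [DecidableEq V] {G : ColoredDAG V C}
  {π : V ≃ Fin (Fintype.card V)}

/-- The parental principal minors do not vanish on the model: the identity matrix, which has the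
parameters `ω = 1` and `Λ = 0`, lies in it, and all principal minors of it are `1`. -/
theorem pullback_ne_zero_of_mem_parentalMinors (hπ : G.IsTopologicalOrdering π)
    {g : MvPolynomial (Sym2 V) ℝ} (hg : g ∈ G.parentalMinors) : G.pullback g ≠ 0 := by
  have h : G.IsColoredParameter (fun _ => (1 : ℝ)) 0 :=
    ⟨fun _ _ _ => rfl, fun _ _ _ => rfl, fun _ _ _ _ _ _ _ => rfl⟩
  obtain ⟨x, hω, hΛ⟩ := h.exists_eval
  have hq := map_covariance_vars hπ (MvPolynomial.aeval x) hω hΛ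
  have hone : covariance (fun _ : V => (1 : ℝ)) 0 = 1 := by
    rw [covariance, Matrix.diagonal_one]
    simp
  rw [hone] at hq
  obtain ⟨k, rfl⟩ := hg
  intro h₀
  have h₁ : ((MvPolynomial.aeval x).comp G.pullback)
      (∏ i, principalMinor (G.parents i) ^ k i) = 1 := by
    rw [map_prod]
    refine Finset.prod_eq_one fun i _ => ?_
    rw [map_pow, apply_principalMinor, hq, Matrix.principalDet,
      Matrix.submatrix_one _ Subtype.val_injective, Matrix.det_one, one_pow]
  rw [AlgHom.comp_apply, h₀, map_zero] at h₁
  exact zero_ne_one h₁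

theorem saturationBy_le_vanishingIdeal (hπ : G.IsTopologicalOrdering π) :
    (G.localCIIdeal π).saturationBy G.parentalMinors ≤ G.vanishingIdeal := by
  rintro f ⟨g, hg, hfg⟩
  have h : G.pullback (f * g) = 0 :=
    localCIIdeal_le_ker hπ G.isColoredParameter_vars G.sigmaImage_pullback hfg
  rw [map_mul] at h
  exact (mul_eq_zero.1 h).resolve_right (pullback_ne_zero_of_mem_parentalMinors hπ hg)

end Nonvanishing

/-! ### Recovering the parameters where the parental minors are invertible -/

section Recovery

variable {V C A : Type*} [Fintype V] [DecidableEq V] [CommRing A] [Algebra ℝ A]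
  {G : ColoredDAG V C} {π : V ≃ Fin (Fintype.card V)}

/-- If a homomorphism kills the local relations and inverts the parental principal minors, then
it sends `Σ` to the covariance matrix of the parameters `ω_j = |Σ_{pa(j) ∪ j}| / |Σ_{pa(j)}|` and
`λ_{ij} = |Σ_{ij|pa(j) ∖ i}| / |Σ_{pa(j)}|`: these satisfy the structural equations by Cramer's rule
and the conditional independence relations, and the coloring by the coloring relations. -/
theorem exists_isColoredParameter_of_localCIIdeal_le_ker (hπ : G.IsTopologicalOrdering π)
    {q : MvPolynomial (Sym2 V) ℝ →ₐ[ℝ] A} (hI : G.localCIIdeal π ≤ RingHom.ker q)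
    (hu : ∀ j, IsUnit (q (principalMinor (G.parents j)))) :
    ∃ ω Λ, G.IsColoredParameter ω Λ ∧ sigmaImage q = covariance ω Λ := by
  classical
  choose u hu using hu
  let ω : V → A := fun j => q (principalMinor (insert j (G.parents j))) * ↑(u j)⁻¹
  let Λ : Matrix V V A := Matrix.of fun i j =>
    if G.graph.Adj i j then q (G.cir i j) * ↑(u j)⁻¹ else 0
  have hcross {a b : A} {i j : V} (hab : ↑(u j) * a = ↑(u i) * b) :
      a * ↑(u i)⁻¹ = b * ↑(u j)⁻¹ := by
    rw [Units.mul_inv_eq_iff_eq_mul, mul_right_comm, Units.eq_mul_inv_iff_mul_eq, mul_comm a,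
      mul_comm b, hab]
  have hpar : G.IsColoredParameter ω Λ := by
    refine ⟨fun i j hc => hcross ?_, fun i j hij => if_neg hij, fun i j k l hij hkl hc => ?_⟩
    · have h : q (G.vcr i j) = 0 :=
        hI (Ideal.mem_sup_right (Ideal.subset_span (Or.inl ⟨i, j, hc, rfl⟩)))
      rw [vcr, map_sub, map_mul, map_mul, sub_eq_zero] at h
      rwa [hu, hu]
    · have h : q (G.ecr i j k l) = 0 :=
        hI (Ideal.mem_sup_right (Ideal.subset_span (Or.inr ⟨i, j, k, l, hij, hkl, hc, rfl⟩)))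
      rw [ecr, map_sub, map_mul, map_mul, sub_eq_zero] at h
      simp only [Λ, Matrix.of_apply, if_pos hij, if_pos hkl]
      refine hcross ?_
      rwa [hu, hu]
  refine ⟨ω, Λ, hpar, eq_covariance_of_structural_equations (hpar.isStrictlyUpper hπ)
    (sigmaImage_symm q) fun i j hij => ?_⟩
  have hdet (j) : (sigmaImage q).principalDet (G.parents j) = u j := by
    rw [hu, apply_principalMinor]
  have hreg (k) (hk : k ∈ G.parents j) :
      sigmaImage q k j = ∑ l ∈ G.parents j, sigmaImage q k l * Λ l j := by
    have hcramer := (sigmaImage q).sum_mul_almostPrincipalDet_erase (j := j) hk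
    rw [hdet] at hcramer
    rw [← (Units.inv_mul_eq_iff_eq_mul (u j)).2 hcramer, Finset.mul_sum]
    refine Finset.sum_congr rfl fun l hl => ?_
    simp only [Λ, Matrix.of_apply, if_pos (mem_parents.1 hl), cir, apply_almostPrincipalMinor]
    ring
  rw [hpar.sum_mul_eq]
  by_cases hadj : G.graph.Adj i j
  · have hne : i ≠ j := by
      rintro rfl
      exact G.notMem_parents_self i (mem_parents.2 hadj)
    rw [if_neg hne, add_zero]
    exact hreg i (mem_parents.2 hadj)
  · have hschur := (sigmaImage q).almostPrincipalDet_of_regression i hreg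
    rw [hdet] at hschur
    rw [← sub_eq_iff_eq_add', (Units.eq_mul_inv_iff_mul_eq (u j)).2 hschur.symm]
    split_ifs with e
    · subst e
      simp only [ω, apply_principalMinor, Matrix.principalDet_insert _ (G.notMem_parents_self i)]
    · have hlt : π i < π j := lt_of_le_of_ne hij (π.injective.ne e)
      have h : q (G.cir i j) = 0 :=
        hI (Ideal.mem_sup_left (Ideal.subset_span ⟨i, j, hlt, hadj, rfl⟩))
      rw [cir, apply_almostPrincipalMinor, Finset.erase_eq_of_notMem (mt mem_parents.1 hadj)] at h
      rw [h, zero_mul]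

/-- The recovery of the parameters is applied to the quotient by the local ideal, localized at the
parental principal minors: a polynomial is zero there if and only if it lies in the saturation. -/
theorem vanishingIdeal_le_saturationBy_of_isLocalization (hπ : G.IsTopologicalOrdering π)
    (L : Type*) [CommRing L] [Algebra ℝ L] [Algebra (MvPolynomial (Sym2 V) ℝ ⧸ G.localCIIdeal π) L]
    [IsScalarTower ℝ (MvPolynomial (Sym2 V) ℝ ⧸ G.localCIIdeal π) L]
    [IsLocalization (G.parentalMinors.map (Ideal.Quotient.mk (G.localCIIdeal π))) L] :
    G.vanishingIdeal ≤ (G.localCIIdeal π).saturationBy G.parentalMinors := by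
  let q : MvPolynomial (Sym2 V) ℝ →ₐ[ℝ] L :=
    (IsScalarTower.toAlgHom ℝ (MvPolynomial (Sym2 V) ℝ ⧸ G.localCIIdeal π) L).comp
      (Ideal.Quotient.mkₐ ℝ (G.localCIIdeal π))
  have hq (f) : q f = algebraMap _ L (Ideal.Quotient.mk (G.localCIIdeal π) f) := rfl
  have hI : G.localCIIdeal π ≤ RingHom.ker q := fun f hf => by
    rw [RingHom.mem_ker, hq, Ideal.Quotient.eq_zero_iff_mem.2 hf, map_zero]
  have hu (j) : IsUnit (q (principalMinor (G.parents j))) := by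
    have hmem : principalMinor (G.parents j) ∈ G.parentalMinors := by
      refine ⟨Pi.single j 1, ?_⟩
      rw [Finset.prod_eq_single j (fun i _ hi => by simp [hi]) (by simp)]
      simp
    exact IsLocalization.map_units L
      (⟨_, Submonoid.mem_map_of_mem (Ideal.Quotient.mk (G.localCIIdeal π)) hmem⟩ :
        G.parentalMinors.map (Ideal.Quotient.mk (G.localCIIdeal π)))
  obtain ⟨ω, Λ, hpar, hcov⟩ := exists_isColoredParameter_of_localCIIdeal_le_ker hπ hI hu
  intro f hf
  have h : q f = 0 := vanishingIdeal_le_ker hπ hpar hcov hf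
  rw [hq, IsLocalization.map_eq_zero_iff
    (G.parentalMinors.map (Ideal.Quotient.mk (G.localCIIdeal π)))] at h
  obtain ⟨⟨_, g, hg, rfl⟩, h⟩ := h
  refine ⟨g, hg, Ideal.Quotient.eq_zero_iff_mem.1 ?_⟩
  rw [map_mul, mul_comm]
  exact h

theorem vanishingIdeal_le_saturationBy (hπ : G.IsTopologicalOrdering π) :
    G.vanishingIdeal ≤ (G.localCIIdeal π).saturationBy G.parentalMinors :=
  vanishingIdeal_le_saturationBy_of_isLocalization hπ
    (Localization (G.parentalMinors.map (Ideal.Quotient.mk (G.localCIIdeal π))))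

end Recovery

/-! ### Polynomials vanishing on the model -/

section Model

variable {V C : Type*} [Fintype V] [DecidableEq V] {G : ColoredDAG V C}
  {π : V ≃ Fin (Fintype.card V)}

/-- Positive real values of the variables of the parameter ring, which form a product of infinite
sets, give points of the model. Hence a polynomial that vanishes on the model pulls back to zero. -/
theorem vanishingIdeal_modelPoints (hπ : G.IsTopologicalOrdering π) :
    MvPolynomial.vanishingIdeal ℝ G.modelPoints = G.vanishingIdeal := by
  ext f
  rw [MvPolynomial.mem_vanishingIdeal_iff]
  constructor
  · intro hf
    change G.pullback f = 0
    refine MvPolynomial.funext_set (fun _ => Set.Ioi (0 : ℝ)) (fun _ => Set.Ioi_infinite _)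
      fun x hx => ?_
    let e : MvPolynomial (Set.range G.color) ℝ →ₐ[ℝ] ℝ := MvPolynomial.aeval x
    have hpar := G.isColoredParameter_vars.map e.toRingHom
    have hcov : sigmaImage (e.comp G.pullback) =
        covariance (fun i => e (G.omegaVar i)) (G.lambdaVar.map e) :=
      map_covariance_vars hπ e (fun _ => rfl) fun _ _ => rfl
    let y : Sym2 V → ℝ := fun s => e (G.pullback (MvPolynomial.X s))
    have hy : MvPolynomial.aeval y = e.comp G.pullback :=
      MvPolynomial.algHom_ext fun s => by simp [y]
    have hmem : y ∈ G.modelPoints := by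
      refine ⟨(fun i => e (G.omegaVar i), G.lambdaVar.map e),
        ⟨fun i => ?_, hpar.omega_eq, hpar.lambda_eq_zero, hpar.lambda_eq⟩, ?_⟩
      · simpa [e, omegaVar] using hx ⟨G.color (Sum.inl i), Set.mem_range_self _⟩ (Set.mem_univ _)
      · change covariance (fun i => e (G.omegaVar i)) (G.lambdaVar.map e) = symmMatrix y
        rw [← hcov, ← hy, sigmaImage_aeval]
    have h := hf y hmem
    rw [hy] at h
    rw [map_zero]
    exact h
  · rintro hf x ⟨p, ⟨-, hω, h₀, hΛ⟩, hp⟩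
    have hpar : G.IsColoredParameter p.1 p.2 := ⟨hω, h₀, hΛ⟩
    exact vanishingIdeal_le_ker hπ hpar ((sigmaImage_aeval x).trans hp.symm) hf

end Model

end

end ColoredDAG

/-- The vanishing ideal of a colored Gaussian DAG model, i.e. the kernel of the pullback of the
parametrization and equally the ideal of all polynomials that vanish at every covariance matrix of
the model, is the saturation `I_{G,c} : S_G`. -/
theorem mainTheorem4 {V C : Type*} [Fintype V] [DecidableEq V] [Finite C]
    (G : ColoredDAG V C) (π : V ≃ Fin (Fintype.card V)) (hπ : G.IsTopologicalOrdering π) :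
    G.vanishingIdeal = (G.localCIIdeal π).saturationBy G.parentalMinors ∧
      MvPolynomial.vanishingIdeal ℝ G.modelPoints =
        (G.localCIIdeal π).saturationBy G.parentalMinors := by
  have h := le_antisymm (ColoredDAG.vanishingIdeal_le_saturationBy hπ)
    (ColoredDAG.saturationBy_le_vanishingIdeal hπ)
  exact ⟨h, (ColoredDAG.vanishingIdeal_modelPoints hπ).trans h⟩
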